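/- Let $\mathcal G\rightrightarrows M$ be a Lie groupoid (smooth, finite-dimensional, without boundary) with source $s$, target $t$, inversion $\iota$ and multiplication $m:\{(u,u')\in\mathcal G\times\mathcal G: s(u)=t(u')\}\to\mathcal G$, $m(u,u')=u*u'$. Let $\mathcal G$ be a Cartan-Lie groupoid, that is, equipped with a smooth distribution $H\subset T\mathcal G$ of rank $n=\dim M$ such that for every $u\in\mathcal G$ both $\mathrm ds:H_u\to T_{s(u)}M$ and $\mathrm dt:H_u\to T_{t(u)}M$ are isomorphisms, and which is multiplicative: if $s(u)=t(u')$, $v\in H_u$, $v'\in H_{u'}$ and $\mathrm ds(v)=\mathrm dt(v')$, then $\mathrm dm(v,v')\in H_{u*u'}$. For $s(u)=t(u')$ define the left translation $L_u:T_{u'}\mathcal G\to T_{u*u'}\mathcal G$ by $L_u(v')=\mathrm dm(w,v')$, where $w\in H_u$ is the unique vector with $\mathrm ds(w)=\mathrm dt(v')$, and the right translation $R_{u'}:T_u\mathcal G\to T_{u*u'}\mathcal G$ by $R_{u'}(v)=\mathrm dm(v,w')$, where $w'\in H_{u'}$ is the unique vector with $\mathrm ds(v)=\mathrm dt(w')$.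 Let $\eta$ be a bi-invariant (smooth) Riemannian metric on $\mathcal G$, that is, $L_{u_1}^*(\eta_{u_1*u_2})=\eta_{u_2}$ and $R_{u_2}^*(\eta_{u_1*u_2})=\eta_{u_1}$ for all $u_1,u_2$ with $s(u_1)=t(u_2)$. Then there exist smooth Riemannian metrics $g_1$ and $g_2$ on $M$ such that $s:(\mathcal G,\eta)\to(M,g_1)$ and $t:(\mathcal G,\eta)\to(M,g_2)$ are Riemannian submersions. If, in addition, $\eta$ is preserved by $\iota$, then necessarily $g_1=g_2$: any two smooth Riemannian metrics $g_1,g_2$ on $M$ for which $s:(\mathcal G,\eta)\to(M,g_1)$ and $t:(\mathcal G,\eta)\to(M,g_2)$ are Riemannian submersions coincide. -/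

import Mathlib

open scoped Manifold ContDiff

noncomputable section

/-- The canonical identification of the tangent spaces at two equal points. -/
def tangentCast {E : Type*} [NormedAddCommGroup E] [NormedSpace ℝ E]
    {N : Type*} [TopologicalSpace N] [ChartedSpace E N] {x y : N} (h : x = y) :
    TangentSpace 𝓘(ℝ, E) x ≃ₗ[ℝ] TangentSpace 𝓘(ℝ, E) y :=
  h ▸ LinearEquiv.refl ℝ (TangentSpace 𝓘(ℝ, E) x)

/-- A Lie groupoid `G ⇉ M` with source `s`, target `t`, units `one`, inversion `inv` and
multiplication `mul`; here `mul u u'` is the product of `u` and `u'` when `s u = t u'`, and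
its value is irrelevant for all other pairs. The maps `s` and `t` are submersions, so that the
set of composable pairs is an embedded submanifold of `G × G`, and smoothness of the
multiplication on it is smoothness on that subset of `G × G`. -/
structure LieGroupoid
    (EG : Type*) [NormedAddCommGroup EG] [NormedSpace ℝ EG]
    (G : Type*) [TopologicalSpace G] [ChartedSpace EG G]
    (EM : Type*) [NormedAddCommGroup EM] [NormedSpace ℝ EM]
    (M : Type*) [TopologicalSpace M] [ChartedSpace EM M] where
  s : G → M
  t : G → M
  one : M → G
  inv : G → G
  mul : G → G → G
  isSubmersion_s : Manifold.IsSubmersion 𝓘(ℝ, EG) 𝓘(ℝ, EM) ∞ s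
  isSubmersion_t : Manifold.IsSubmersion 𝓘(ℝ, EG) 𝓘(ℝ, EM) ∞ t
  contMDiff_one : ContMDiff 𝓘(ℝ, EM) 𝓘(ℝ, EG) ∞ one
  contMDiff_inv : ContMDiff 𝓘(ℝ, EG) 𝓘(ℝ, EG) ∞ inv
  contMDiffOn_mul : ContMDiffOn (𝓘(ℝ, EG).prod 𝓘(ℝ, EG)) 𝓘(ℝ, EG) ∞
    (fun p : G × G => mul p.1 p.2) {p : G × G | s p.1 = t p.2}
  s_mul : ∀ u u' : G, s u = t u' → s (mul u u') = s u'
  t_mul : ∀ u u' : G, s u = t u' → t (mul u u') = t u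
  mul_assoc : ∀ u u' u'' : G, s u = t u' → s u' = t u'' →
    mul (mul u u') u'' = mul u (mul u' u'')
  s_one : ∀ x : M, s (one x) = x
  t_one : ∀ x : M, t (one x) = x
  one_mul : ∀ u : G, mul (one (t u)) u = u
  mul_one : ∀ u : G, mul u (one (s u)) = u
  s_inv : ∀ u : G, s (inv u) = t u
  t_inv : ∀ u : G, t (inv u) = s u
  inv_mul : ∀ u : G, mul (inv u) u = one (s u)
  mul_inv : ∀ u : G, mul u (inv u) = one (t u)

namespace LieGroupoid

variable
  {EG : Type*} [NormedAddCommGroup EG] [NormedSpace ℝ EG]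
  {G : Type*} [TopologicalSpace G] [ChartedSpace EG G]
  {EM : Type*} [NormedAddCommGroup EM] [NormedSpace ℝ EM]
  {M : Type*} [TopologicalSpace M] [ChartedSpace EM M]

/-- The set of composable pairs. -/
def composable (𝒢 : LieGroupoid EG G EM M) : Set (G × G) :=
  {p | 𝒢.s p.1 = 𝒢.t p.2}

/-- The differential of the source map. -/
def ds (𝒢 : LieGroupoid EG G EM M) (u : G) :
    TangentSpace 𝓘(ℝ, EG) u →L[ℝ] TangentSpace 𝓘(ℝ, EM) (𝒢.s u) :=
  mfderiv 𝓘(ℝ, EG) 𝓘(ℝ, EM) 𝒢.s u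

/-- The differential of the target map. -/
def dt (𝒢 : LieGroupoid EG G EM M) (u : G) :
    TangentSpace 𝓘(ℝ, EG) u →L[ℝ] TangentSpace 𝓘(ℝ, EM) (𝒢.t u) :=
  mfderiv 𝓘(ℝ, EG) 𝓘(ℝ, EM) 𝒢.t u

/-- The differential of the inversion map. -/
def dinv (𝒢 : LieGroupoid EG G EM M) (u : G) :
    TangentSpace 𝓘(ℝ, EG) u →L[ℝ] TangentSpace 𝓘(ℝ, EG) (𝒢.inv u) :=
  mfderiv 𝓘(ℝ, EG) 𝓘(ℝ, EG) 𝒢.inv u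

/-- The differential of the multiplication at the composable pair `(u, u')`, applied to `(v, v')`.
It is meaningful for vectors tangent to the submanifold of composable pairs, that is, when
`ds v = dt v'`: on these, all derivatives of the multiplication within that submanifold agree. -/
def dmul (𝒢 : LieGroupoid EG G EM M) (u u' : G)
    (v : TangentSpace 𝓘(ℝ, EG) u) (v' : TangentSpace 𝓘(ℝ, EG) u') :
    TangentSpace 𝓘(ℝ, EG) (𝒢.mul u u') :=
  mfderivWithin (𝓘(ℝ, EG).prod 𝓘(ℝ, EG)) 𝓘(ℝ, EG)
    (fun p : G × G => 𝒢.mul p.1 p.2) 𝒢.composable (u, u') (v, v')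

end LieGroupoid

/-- A distribution `H` (a family of subspaces of the tangent spaces of `N`) is smooth of rank `n`
if near every point it is spanned by `n` pointwise linearly independent smooth vector fields. -/
def IsSmoothDistribution {E : Type*} [NormedAddCommGroup E] [NormedSpace ℝ E]
    {N : Type*} [TopologicalSpace N] [ChartedSpace E N] [IsManifold 𝓘(ℝ, E) ∞ N]
    (n : ℕ) (H : ∀ u : N, Submodule ℝ (TangentSpace 𝓘(ℝ, E) u)) : Prop :=
  ∀ u₀ : N, ∃ U : Set N, IsOpen U ∧ u₀ ∈ U ∧
    ∃ X : Fin n → ∀ u : N, TangentSpace 𝓘(ℝ, E) u,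
      (∀ i, ContMDiffOn 𝓘(ℝ, E) 𝓘(ℝ, E).tangent ∞
        (fun u => (⟨u, X i u⟩ : TangentBundle 𝓘(ℝ, E) N)) U) ∧
      ∀ u ∈ U, LinearIndependent ℝ (fun i => X i u) ∧
        Submodule.span ℝ (Set.range fun i => X i u) = H u

/-- A Cartan-Lie groupoid: a Lie groupoid over an `n`-dimensional base with a multiplicative smooth
rank `n` distribution `H` whose subspaces are both `s`-projectible and `t`-projectible. -/
structure CartanLieGroupoid
    (EG : Type*) [NormedAddCommGroup EG] [NormedSpace ℝ EG]
    (G : Type*) [TopologicalSpace G] [ChartedSpace EG G] [IsManifold 𝓘(ℝ, EG) ∞ G]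
    (EM : Type*) [NormedAddCommGroup EM] [NormedSpace ℝ EM]
    (M : Type*) [TopologicalSpace M] [ChartedSpace EM M]
    extends LieGroupoid EG G EM M where
  H : ∀ u : G, Submodule ℝ (TangentSpace 𝓘(ℝ, EG) u)
  smooth_H : IsSmoothDistribution (Module.finrank ℝ EM) H
  s_projectible : ∀ u : G,
    Function.Bijective ((toLieGroupoid.ds u).toLinearMap.domRestrict (H u))
  t_projectible : ∀ u : G,
    Function.Bijective ((toLieGroupoid.dt u).toLinearMap.domRestrict (H u))
  multiplicative : ∀ (u u' : G) (h : s u = t u'), ∀ v ∈ H u, ∀ v' ∈ H u',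
    tangentCast h (toLieGroupoid.ds u v) = toLieGroupoid.dt u' v' →
      toLieGroupoid.dmul u u' v v' ∈ H (mul u u')

namespace CartanLieGroupoid

variable
  {EG : Type*} [NormedAddCommGroup EG] [NormedSpace ℝ EG]
  {G : Type*} [TopologicalSpace G] [ChartedSpace EG G] [IsManifold 𝓘(ℝ, EG) ∞ G]
  {EM : Type*} [NormedAddCommGroup EM] [NormedSpace ℝ EM]
  {M : Type*} [TopologicalSpace M] [ChartedSpace EM M]

/-- The horizontal lift at `u` along `s`: the inverse of `ds : H u → T_{s u} M`. -/
def sLift (𝒢 : CartanLieGroupoid EG G EM M) (u : G) :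
    TangentSpace 𝓘(ℝ, EM) (𝒢.s u) ≃ₗ[ℝ] 𝒢.H u :=
  (LinearEquiv.ofBijective ((𝒢.ds u).toLinearMap.domRestrict (𝒢.H u)) (𝒢.s_projectible u)).symm

/-- The horizontal lift at `u` along `t`: the inverse of `dt : H u → T_{t u} M`. -/
def tLift (𝒢 : CartanLieGroupoid EG G EM M) (u : G) :
    TangentSpace 𝓘(ℝ, EM) (𝒢.t u) ≃ₗ[ℝ] 𝒢.H u :=
  (LinearEquiv.ofBijective ((𝒢.dt u).toLinearMap.domRestrict (𝒢.H u)) (𝒢.t_projectible u)).symm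

/-- Left translation by `u`, from `T_{u'} G` to `T_{u u'} G`: it sends `v'` to `dm (w, v')`, where
`w` is the unique vector of `H u` with `ds w = dt v'`. -/
def leftTranslation (𝒢 : CartanLieGroupoid EG G EM M) {u u' : G} (h : 𝒢.s u = 𝒢.t u')
    (v' : TangentSpace 𝓘(ℝ, EG) u') : TangentSpace 𝓘(ℝ, EG) (𝒢.mul u u') :=
  𝒢.dmul u u' (𝒢.sLift u (tangentCast h.symm (𝒢.dt u' v'))) v'

/-- Right translation by `u'`, from `T_u G` to `T_{u u'} G`: it sends `v` to `dm (v, w')`, where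
`w'` is the unique vector of `H u'` with `ds v = dt w'`. -/
def rightTranslation (𝒢 : CartanLieGroupoid EG G EM M) {u u' : G} (h : 𝒢.s u = 𝒢.t u')
    (v : TangentSpace 𝓘(ℝ, EG) u) : TangentSpace 𝓘(ℝ, EG) (𝒢.mul u u') :=
  𝒢.dmul u u' v (𝒢.tLift u' (tangentCast h (𝒢.ds u v)))

end CartanLieGroupoid

/-- Smooth Riemannian metrics on a manifold. -/
abbrev RiemMetric (E : Type*) [NormedAddCommGroup E] [NormedSpace ℝ E]
    (N : Type*) [TopologicalSpace N] [ChartedSpace E N] [IsManifold 𝓘(ℝ, E) ∞ N] :=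
  Bundle.ContMDiffRiemannianMetric 𝓘(ℝ, E) ∞ E (fun x : N => TangentSpace 𝓘(ℝ, E) x)

namespace CartanLieGroupoid

variable
  {EG : Type*} [NormedAddCommGroup EG] [NormedSpace ℝ EG]
  {G : Type*} [TopologicalSpace G] [ChartedSpace EG G] [IsManifold 𝓘(ℝ, EG) ∞ G]
  {EM : Type*} [NormedAddCommGroup EM] [NormedSpace ℝ EM]
  {M : Type*} [TopologicalSpace M] [ChartedSpace EM M]

/-- A metric on a Cartan-Lie groupoid is bi-invariant if it is preserved by all left and right
translations. -/
def IsBiInvariant (𝒢 : CartanLieGroupoid EG G EM M) (η : RiemMetric EG G) : Prop :=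
  ∀ (u₁ u₂ : G) (h : 𝒢.s u₁ = 𝒢.t u₂),
    (∀ v w : TangentSpace 𝓘(ℝ, EG) u₂,
      η.inner (𝒢.mul u₁ u₂) (𝒢.leftTranslation h v) (𝒢.leftTranslation h w) = η.inner u₂ v w) ∧
    (∀ v w : TangentSpace 𝓘(ℝ, EG) u₁,
      η.inner (𝒢.mul u₁ u₂) (𝒢.rightTranslation h v) (𝒢.rightTranslation h w) = η.inner u₁ v w)

/-- The metric is preserved by the inversion map. -/
def IsInversionInvariant (𝒢 : CartanLieGroupoid EG G EM M) (η : RiemMetric EG G) : Prop :=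
  ∀ (u : G) (v w : TangentSpace 𝓘(ℝ, EG) u),
    η.inner (𝒢.inv u) (𝒢.dinv u v) (𝒢.dinv u w) = η.inner u v w

end CartanLieGroupoid

/-- A Riemannian submersion `f : (N, η) → (M, g)`: a surjective submersion whose differential maps
the orthogonal complement of the vertical space isometrically to the tangent space of `M`. -/
structure IsRiemannianSubmersion
    {EN : Type*} [NormedAddCommGroup EN] [NormedSpace ℝ EN]
    {N : Type*} [TopologicalSpace N] [ChartedSpace EN N] [IsManifold 𝓘(ℝ, EN) ∞ N]
    {EM : Type*} [NormedAddCommGroup EM] [NormedSpace ℝ EM]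
    {M : Type*} [TopologicalSpace M] [ChartedSpace EM M] [IsManifold 𝓘(ℝ, EM) ∞ M]
    (η : RiemMetric EN N) (g : RiemMetric EM M) (f : N → M) : Prop where
  isSubmersion : Manifold.IsSubmersion 𝓘(ℝ, EN) 𝓘(ℝ, EM) ∞ f
  surjective : Function.Surjective f
  isometry : ∀ (u : N) (v w : TangentSpace 𝓘(ℝ, EN) u),
    (∀ k, mfderiv 𝓘(ℝ, EN) 𝓘(ℝ, EM) f u k = 0 → η.inner u v k = 0) →
    (∀ k, mfderiv 𝓘(ℝ, EN) 𝓘(ℝ, EM) f u k = 0 → η.inner u w k = 0) →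
    g.inner (f u) (mfderiv 𝓘(ℝ, EN) 𝓘(ℝ, EM) f u v) (mfderiv 𝓘(ℝ, EN) 𝓘(ℝ, EM) f u w)
      = η.inner u v w

end

/-!
The argument compares the forms that `η` induces on the tangent spaces of `M` at the various points
of a fibre of `s`. At `u`, the orthogonal complement of `ker ds` carries `η` and is isomorphic to
`T_{s u} M`; this gives the form `pointQuotientForm η s u`, and `s` is a Riemannian submersion onto
`(M, g)` exactly when `g` at `s u` is this form for every `u`.

The map `s` intertwines left translations, `ds (dm (w, v')) = ds v'` (`LieGroupoid.ds_dmul`), and by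
bi-invariance left translations are isometries, hence bijective since all tangent spaces of `G`
have the same dimension. So the induced form at `u * u'` is the one at `u'`
(`CartanLieGroupoid.pointQuotientForm_s_mul`). As `u = u * 1_{s u}`, the form at `u` is the form at
the unit `1_{s u}`, which depends on `s u` only. The same reasoning with right translations and
`u = 1_{t u} * u` applies to `t`. Inversion exchanges `s` and `t`, so if it is an isometry, then the
form induced by `s` at `u` is the one induced by `t` at the inverse of `u`, and the two metrics
coincide.

Two points need care. The differential of `m` is a derivative within the set of composable pairs,
which determines it only on vectors tangent to that set; `LieGroupoid.mfderiv_dmul` handles this by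
composing `m` with a smooth local retraction of `G × G` onto the composable pairs, obtained from
submersion charts of `s` (`Manifold.IsSubmersionAt.exists_lift`). Smoothness of the metrics on `M`
follows from the formula `(A ∘ B⁻¹ ∘ Aᵀ)⁻¹` for the quotient of a form `B` along a surjection `A`
(`quotientForm`), applied in local trivializations along the smooth section `x ↦ 1_x`
(`contMDiff_pointQuotientForm`).
-/

open scoped Topology

/-! ### Quotients of positive definite forms -/

section LinearAlgebra

variable {V : Type*} [NormedAddCommGroup V] [NormedSpace ℝ V]
  {V' : Type*} [NormedAddCommGroup V'] [NormedSpace ℝ V']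
  {W : Type*} [NormedAddCommGroup W] [NormedSpace ℝ W]

/-- `IsQuotientForm B A g` says that `A : V → W` maps the `B`-orthogonal complement of its kernel
isometrically to `W` with the bilinear form `g`. -/
def IsQuotientForm (B : V →L[ℝ] V →L[ℝ] ℝ) (A : V →L[ℝ] W) (g : W →L[ℝ] W →L[ℝ] ℝ) : Prop :=
  ∀ v w : V, (∀ k, A k = 0 → B v k = 0) → (∀ k, A k = 0 → B w k = 0) → g (A v) (A w) = B v w

/-- The form induced by `B` on the dual of `W`, namely `A ∘ B⁻¹ ∘ Aᵀ`, where bilinear forms are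
regarded as maps to the dual. -/
noncomputable def dualQuotientForm (B : V →L[ℝ] V →L[ℝ] ℝ) (A : V →L[ℝ] W) :
    (W →L[ℝ] ℝ) →L[ℝ] W :=
  (A ∘L B.inverse) ∘L (ContinuousLinearMap.compL ℝ V W ℝ).flip A

/-- The quotient of the form `B` along `A : V → W`, as the inverse of the dual form. It is meant for
positive definite `B` and surjective `A`; `ContinuousLinearMap.inverse` is `0` on maps that are not
invertible. -/
noncomputable def quotientForm (B : V →L[ℝ] V →L[ℝ] ℝ) (A : V →L[ℝ] W) : W →L[ℝ] W →L[ℝ] ℝ :=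
  (dualQuotientForm B A).inverse

/-- A positive definite form on a finite-dimensional space is bounded below by a positive multiple
of the square of the norm, so its unit ball is bounded. -/
theorem isVonNBounded_of_posDef [FiniteDimensional ℝ V] (B : V →L[ℝ] V →L[ℝ] ℝ)
    (hpos : ∀ v, v ≠ 0 → 0 < B v v) : Bornology.IsVonNBounded ℝ {v : V | B v v < 1} := by
  rw [NormedSpace.isVonNBounded_iff]
  have : ProperSpace V := FiniteDimensional.proper ℝ V
  rcases (Metric.sphere (0 : V) 1).eq_empty_or_nonempty with h | h
  · have h0 : ∀ v : V, v = 0 := by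
      intro v
      by_contra hv
      have : (‖v‖⁻¹ • v) ∈ Metric.sphere (0 : V) 1 := by
        simp [norm_smul, norm_ne_zero_iff.2 hv]
      simp [h] at this
    exact Bornology.IsBounded.subset Bornology.isBounded_singleton (fun v _ => h0 v)
  obtain ⟨v₀, hv₀, hmin⟩ := (isCompact_sphere (0 : V) 1).exists_isMinOn h
    (f := fun v => B v v) (by fun_prop)
  have hv₀' : v₀ ≠ 0 := by
    rintro rfl
    simp at hv₀
  have hc := hpos v₀ hv₀'
  refine (isBounded_iff_forall_norm_le).2 ⟨Real.sqrt ((B v₀ v₀)⁻¹), fun v hv => ?_⟩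
  apply Real.le_sqrt_of_sq_le
  rcases eq_or_ne v 0 with rfl | hv0
  · simp [hc.le]
  have hn : 0 < ‖v‖ := norm_pos_iff.2 hv0
  have h1 : B v₀ v₀ ≤ B (‖v‖⁻¹ • v) (‖v‖⁻¹ • v) :=
    hmin (show (‖v‖⁻¹ • v) ∈ Metric.sphere (0 : V) 1 by simp [norm_smul, hn.ne'])
  simp only [map_smul, _root_.smul_apply, smul_eq_mul] at h1
  have hv1 : B v v < 1 := hv
  rw [le_inv_comm₀ (by positivity) hc]
  refine h1.trans ?_
  calc ‖v‖⁻¹ * (‖v‖⁻¹ * B v v) = (‖v‖ ^ 2)⁻¹ * B v v := by field_simp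
    _ ≤ (‖v‖ ^ 2)⁻¹ * 1 := by gcongr
    _ = (‖v‖ ^ 2)⁻¹ := mul_one _

theorem isInvertible_of_posDef [FiniteDimensional ℝ V] {B : V →L[ℝ] V →L[ℝ] ℝ}
    (hpos : ∀ v, v ≠ 0 → 0 < B v v) : B.IsInvertible := by
  have hinj : Function.Injective B := by
    rw [injective_iff_map_eq_zero]
    intro v hv
    by_contra h
    simpa [hv] using hpos v h
  have hdim : Module.finrank ℝ V = Module.finrank ℝ (V →L[ℝ] ℝ) := by
    rw [← (LinearMap.toContinuousLinearMap (𝕜 := ℝ) (E := V) (F' := ℝ)).finrank_eq]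
    exact Subspace.dual_finrank_eq.symm
  exact ⟨(LinearEquiv.ofInjectiveOfFinrankEq B.toLinearMap hinj hdim).toContinuousLinearEquiv,
    by ext; rfl⟩

/-- The representative `B⁻¹ (Aᵀ α)` of a covector `α` pairs with any `v` as `α` does with `A v`. -/
theorem inverse_comp_apply [FiniteDimensional ℝ V] {B : V →L[ℝ] V →L[ℝ] ℝ}
    (hpos : ∀ v, v ≠ 0 → 0 < B v v) (A : V →L[ℝ] W) (α : W →L[ℝ] ℝ) (v : V) :
    B (B.inverse (α ∘L A)) v = α (A v) := by
  rw [(isInvertible_of_posDef hpos).self_apply_inverse]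
  rfl

theorem dualQuotientForm_apply (B : V →L[ℝ] V →L[ℝ] ℝ) (A : V →L[ℝ] W) (α : W →L[ℝ] ℝ) :
    dualQuotientForm B A α = A (B.inverse (α ∘L A)) := rfl

theorem apply_dualQuotientForm [FiniteDimensional ℝ V] {B : V →L[ℝ] V →L[ℝ] ℝ}
    (hpos : ∀ v, v ≠ 0 → 0 < B v v) (A : V →L[ℝ] W) (α β : W →L[ℝ] ℝ) :
    α (dualQuotientForm B A β) = B (B.inverse (α ∘L A)) (B.inverse (β ∘L A)) := by
  rw [dualQuotientForm_apply, inverse_comp_apply hpos]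

variable [FiniteDimensional ℝ V] [FiniteDimensional ℝ W]
  {B : V →L[ℝ] V →L[ℝ] ℝ} {A : V →L[ℝ] W}

theorem isInvertible_dualQuotientForm (hpos : ∀ v, v ≠ 0 → 0 < B v v)
    (hA : Function.Surjective A) : (dualQuotientForm B A).IsInvertible := by
  have hinj : Function.Injective (dualQuotientForm B A) := by
    rw [injective_iff_map_eq_zero]
    intro α hα
    have h := apply_dualQuotientForm hpos A α α
    rw [hα, map_zero] at h
    have h0 : B.inverse (α ∘L A) = 0 := by
      by_contra h0
      exact (hpos _ h0).ne h
    ext w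
    obtain ⟨v, rfl⟩ := hA w
    rw [← inverse_comp_apply hpos, h0]
    simp
  have hdim : Module.finrank ℝ (W →L[ℝ] ℝ) = Module.finrank ℝ W := by
    rw [← (LinearMap.toContinuousLinearMap (𝕜 := ℝ) (E := W) (F' := ℝ)).finrank_eq]
    exact Subspace.dual_finrank_eq
  exact ⟨(LinearEquiv.ofInjectiveOfFinrankEq (dualQuotientForm B A).toLinearMap
    hinj hdim).toContinuousLinearEquiv, by ext; rfl⟩

theorem exists_dualQuotientForm_eq (hpos : ∀ v, v ≠ 0 → 0 < B v v)
    (hA : Function.Surjective A) (w : W) : ∃ α, dualQuotientForm B A α = w :=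
  ⟨_, (isInvertible_dualQuotientForm hpos hA).self_apply_inverse w⟩

theorem quotientForm_dualQuotientForm (hpos : ∀ v, v ≠ 0 → 0 < B v v)
    (hA : Function.Surjective A) (α : W →L[ℝ] ℝ) :
    quotientForm B A (dualQuotientForm B A α) = α :=
  (isInvertible_dualQuotientForm hpos hA).inverse_apply_self α

theorem quotientForm_symm (hsymm : ∀ v w, B v w = B w v) (hpos : ∀ v, v ≠ 0 → 0 < B v v)
    (hA : Function.Surjective A) (v w : W) : quotientForm B A v w = quotientForm B A w v := by
  obtain ⟨α, rfl⟩ := exists_dualQuotientForm_eq hpos hA v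
  obtain ⟨β, rfl⟩ := exists_dualQuotientForm_eq hpos hA w
  rw [quotientForm_dualQuotientForm hpos hA, quotientForm_dualQuotientForm hpos hA,
    apply_dualQuotientForm hpos, apply_dualQuotientForm hpos, hsymm]

theorem quotientForm_pos (hpos : ∀ v, v ≠ 0 → 0 < B v v)
    (hA : Function.Surjective A) (w : W) (hw : w ≠ 0) : 0 < quotientForm B A w w := by
  obtain ⟨α, rfl⟩ := exists_dualQuotientForm_eq hpos hA w
  rw [quotientForm_dualQuotientForm hpos hA, apply_dualQuotientForm hpos]
  apply hpos
  intro h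
  rw [dualQuotientForm_apply, h, map_zero] at hw
  exact hw rfl

/-- A vector orthogonal to `ker A` represents a covector of the form `α ∘ A`. -/
theorem exists_eq_inverse_comp (hpos : ∀ v, v ≠ 0 → 0 < B v v)
    (hA : Function.Surjective A) {v : V} (hv : ∀ k, A k = 0 → B v k = 0) :
    ∃ α : W →L[ℝ] ℝ, v = B.inverse (α ∘L A) := by
  obtain ⟨σ, hσ⟩ := A.toLinearMap.exists_rightInverse_of_surjective (LinearMap.range_eq_top.2 hA)
  refine ⟨(B v).comp σ.toContinuousLinearMap, ?_⟩
  have : ((B v).comp σ.toContinuousLinearMap) ∘L A = B v := by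
    ext k
    have h := hv (σ (A k) - k) (by
      have := LinearMap.congr_fun hσ (A k)
      simpa [sub_eq_zero] using this)
    simpa [sub_eq_zero] using h
  rw [this, (isInvertible_of_posDef hpos).inverse_apply_self]

theorem isQuotientForm_quotientForm (hpos : ∀ v, v ≠ 0 → 0 < B v v)
    (hA : Function.Surjective A) : IsQuotientForm B A (quotientForm B A) := by
  intro v w hv hw
  obtain ⟨α, rfl⟩ := exists_eq_inverse_comp hpos hA hv
  rw [inverse_comp_apply hpos, ← dualQuotientForm_apply, quotientForm_dualQuotientForm hpos hA]

theorem IsQuotientForm.eq_quotientForm {g : W →L[ℝ] W →L[ℝ] ℝ} (h : IsQuotientForm B A g)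
    (hpos : ∀ v, v ≠ 0 → 0 < B v v) (hA : Function.Surjective A) : g = quotientForm B A := by
  ext v w
  obtain ⟨α, rfl⟩ := exists_dualQuotientForm_eq hpos hA v
  obtain ⟨β, rfl⟩ := exists_dualQuotientForm_eq hpos hA w
  rw [quotientForm_dualQuotientForm hpos hA, apply_dualQuotientForm hpos A α β,
    dualQuotientForm_apply B A α, dualQuotientForm_apply B A β, h]
  all_goals
    intro k hk
    rw [inverse_comp_apply hpos, hk, map_zero]

/-- Quotient forms are natural: an isometry `L` between spaces of equal dimension that intertwines
`A` and `A'` induces the same form on `W`. -/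
theorem quotientForm_eq_of_isometry [FiniteDimensional ℝ V'] {B' : V' →L[ℝ] V' →L[ℝ] ℝ}
    {A' : V' →L[ℝ] W} (hdim : Module.finrank ℝ V = Module.finrank ℝ V') (L : V →ₗ[ℝ] V')
    (hL : ∀ v w, B' (L v) (L w) = B v w) (hAL : ∀ v, A' (L v) = A v)
    (hpos : ∀ v, v ≠ 0 → 0 < B v v) (hpos' : ∀ v, v ≠ 0 → 0 < B' v v)
    (hA : Function.Surjective A) : quotientForm B' A' = quotientForm B A := by
  have hinj : Function.Injective L := by
    rw [injective_iff_map_eq_zero]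
    intro v hv
    by_contra h
    have := hpos v h
    rw [← hL, hv] at this
    simp at this
  have hsurj : Function.Surjective L :=
    (LinearMap.injective_iff_surjective_of_finrank_eq_finrank hdim).1 hinj
  have hA' : Function.Surjective A' := fun w => by
    obtain ⟨v, rfl⟩ := hA w
    exact ⟨L v, hAL v⟩
  refine IsQuotientForm.eq_quotientForm (fun v w hv hw => ?_) hpos hA
  rw [← hAL v, ← hAL w, ← hL]
  have key : ∀ v, (∀ k, A k = 0 → B v k = 0) → ∀ k, A' k = 0 → B' (L v) k = 0 := by
    intro v hv k hk
    obtain ⟨k, rfl⟩ := hsurj k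
    rw [hL]
    exact hv k (by rw [← hAL, hk])
  exact isQuotientForm_quotientForm hpos' hA' _ _ (key v hv) (key w hw)

/-- Changing coordinates by linear isomorphisms of source and target transports quotient forms. -/
theorem quotientForm_congr {W' : Type*} [NormedAddCommGroup W'] [NormedSpace ℝ W']
    [FiniteDimensional ℝ V'] [FiniteDimensional ℝ W'] {B' : V' →L[ℝ] V' →L[ℝ] ℝ}
    {A' : V' →L[ℝ] W'} (P : V' ≃L[ℝ] V) (T : W ≃L[ℝ] W')
    (hB : ∀ v w, B' v w = B (P v) (P w)) (hAA : ∀ v, A' v = T (A (P v)))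
    (hpos : ∀ v, v ≠ 0 → 0 < B v v) (hA : Function.Surjective A) (v w : W') :
    quotientForm B' A' v w = quotientForm B A (T.symm v) (T.symm w) := by
  have hpos' : ∀ v, v ≠ 0 → 0 < B' v v := fun v hv => by
    rw [hB]
    exact hpos _ (by simpa using hv)
  have hA' : Function.Surjective A' := fun w => by
    obtain ⟨v, hv⟩ := hA (T.symm w)
    exact ⟨P.symm v, by simp [hAA, hv]⟩
  have key : IsQuotientForm B' A' ((quotientForm B A).bilinearComp
      (T.symm : W' →L[ℝ] W) (T.symm : W' →L[ℝ] W)) := by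
    intro v w hv hw
    have horth : ∀ v, (∀ k, A' k = 0 → B' v k = 0) → ∀ k, A k = 0 → B (P v) k = 0 := by
      intro v hv k hk
      have := hv (P.symm k) (by simp [hAA, hk])
      simpa [hB] using this
    simpa [hAA, hB] using
      isQuotientForm_quotientForm hpos hA (P v) (P w) (horth v hv) (horth w hw)
  rw [← key.eq_quotientForm hpos' hA']
  rfl

/-- Quotient forms depend smoothly on the form and the map. -/
theorem ContMDiffAt.quotientForm {E : Type*} [NormedAddCommGroup E] [NormedSpace ℝ E]
    {N : Type*} [TopologicalSpace N] [ChartedSpace E N] {x₀ : N}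
    {B : N → V →L[ℝ] V →L[ℝ] ℝ} {A : N → V →L[ℝ] W}
    (hB : ContMDiffAt 𝓘(ℝ, E) 𝓘(ℝ, V →L[ℝ] V →L[ℝ] ℝ) ∞ B x₀)
    (hA : ContMDiffAt 𝓘(ℝ, E) 𝓘(ℝ, V →L[ℝ] W) ∞ A x₀)
    (hpos : ∀ v, v ≠ 0 → 0 < B x₀ v v) (hsurj : Function.Surjective (A x₀)) :
    ContMDiffAt 𝓘(ℝ, E) 𝓘(ℝ, W →L[ℝ] W →L[ℝ] ℝ) ∞ (fun x => quotientForm (B x) (A x)) x₀ := by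
  have hinv : ContMDiffAt 𝓘(ℝ, E) 𝓘(ℝ, (V →L[ℝ] ℝ) →L[ℝ] V) ∞ (fun x => (B x).inverse) x₀ :=
    (isInvertible_of_posDef hpos).contDiffAt_map_inverse.contMDiffAt.comp x₀ hB
  have hflip : ContDiff ℝ ∞ (fun A : V →L[ℝ] W => (ContinuousLinearMap.compL ℝ V W ℝ).flip A) :=
    ContinuousLinearMap.contDiff _
  have hT : ContMDiffAt 𝓘(ℝ, E) 𝓘(ℝ, (W →L[ℝ] ℝ) →L[ℝ] V →L[ℝ] ℝ) ∞
      (fun x => (ContinuousLinearMap.compL ℝ V W ℝ).flip (A x)) x₀ :=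
    hflip.contMDiff.contMDiffAt.comp x₀ hA
  exact (isInvertible_dualQuotientForm hpos hsurj).contDiffAt_map_inverse.contMDiffAt.comp x₀
    ((hA.clm_comp hinv).clm_comp hT)

end LinearAlgebra

/-! ### Local lifts along submersions -/

section Submersion

variable {EN : Type*} [NormedAddCommGroup EN] [NormedSpace ℝ EN]
  {N : Type*} [TopologicalSpace N] [ChartedSpace EN N]
  {EM : Type*} [NormedAddCommGroup EM] [NormedSpace ℝ EM]
  {M : Type*} [TopologicalSpace M] [ChartedSpace EM M]

/-- Near `u`, a submersion `f` admits a smooth family of moves `r (p, y)` of a point `p` to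
the fibre over `y`, which does not move points already lying over `y`. In submersion charts, `r`
replaces the first coordinate of `p` by `y`. -/
theorem Manifold.IsSubmersionAt.exists_lift {f : N → M} {u : N}
    (h : Manifold.IsSubmersionAt 𝓘(ℝ, EN) 𝓘(ℝ, EM) ∞ f u) :
    ∃ r : N × M → N,
      ContMDiffAt (𝓘(ℝ, EN).prod 𝓘(ℝ, EM)) 𝓘(ℝ, EN) ∞ r (u, f u) ∧
      (∀ᶠ p in 𝓝 u, r (p, f p) = p) ∧ ∀ᶠ q in 𝓝 (u, f u), f (r q) = q.2 := by
  let φ := h.domChart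
  let ψ := h.codChart
  let e := h.equiv
  have hφu : u ∈ φ.source := h.mem_domChart_source
  have hψu : f u ∈ ψ.source := h.mem_codChart_source
  have hloc : ∀ p ∈ φ.source, ψ (f p) = (e (φ p)).1 := by
    intro p hp
    have hp' : φ p ∈ (h.domChart.extend 𝓘(ℝ, EN)).target := by simpa using φ.map_source hp
    have := h.writtenInCharts hp'
    simpa [φ.left_inv hp, φ, ψ, e] using this
  let c : N × M → EN := fun q => e.symm (ψ q.2, (e (φ q.1)).2)
  have hcu : c (u, f u) = φ u := by simp [c, hloc u hφu]
  have hφs : ContMDiffAt 𝓘(ℝ, EN) 𝓘(ℝ, EN) ∞ φ u :=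
    contMDiffAt_of_mem_maximalAtlas h.domChart_mem_maximalAtlas hφu
  have hψs : ContMDiffAt 𝓘(ℝ, EM) 𝓘(ℝ, EM) ∞ ψ (f u) :=
    contMDiffAt_of_mem_maximalAtlas h.codChart_mem_maximalAtlas hψu
  have hc : ContMDiffAt (𝓘(ℝ, EN).prod 𝓘(ℝ, EM)) 𝓘(ℝ, EN) ∞ c (u, f u) := by
    have h1 : ContMDiffAt (𝓘(ℝ, EN).prod 𝓘(ℝ, EM)) 𝓘(ℝ, EM) ∞
        (fun q : N × M => ψ q.2) (u, f u) :=
      ContMDiffAt.comp (u, f u) (g := ψ) (f := Prod.snd) hψs contMDiffAt_snd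
    have h2 : ContMDiffAt (𝓘(ℝ, EN).prod 𝓘(ℝ, EM)) 𝓘(ℝ, EN) ∞
        (fun q : N × M => φ q.1) (u, f u) :=
      ContMDiffAt.comp (u, f u) (g := φ) (f := Prod.fst) hφs contMDiffAt_fst
    have h3 : ContMDiffAt (𝓘(ℝ, EN).prod 𝓘(ℝ, EM)) 𝓘(ℝ, EM × EN) ∞
        (fun q : N × M => (ψ q.2, φ q.1)) (u, f u) := h1.prodMk_space h2
    have h4 : ContDiff ℝ ∞ (fun z : EM × EN => e.symm (z.1, (e z.2).2)) := by fun_prop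
    exact h4.contMDiff.contMDiffAt.comp (u, f u) h3
  have hsymm : ContMDiffAt 𝓘(ℝ, EN) 𝓘(ℝ, EN) ∞ φ.symm (φ u) :=
    contMDiffAt_symm_of_mem_maximalAtlas h.domChart_mem_maximalAtlas (φ.map_source hφu)
  refine ⟨φ.symm ∘ c, ?_, ?_, ?_⟩
  · exact ContMDiffAt.comp_of_eq hsymm hc hcu
  · filter_upwards [φ.open_source.mem_nhds hφu] with p hp
    simp [c, hloc p hp, φ.left_inv hp]
  · have h1 : ∀ᶠ q in 𝓝 (u, f u), c q ∈ φ.target :=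
      hc.continuousAt.eventually_mem
        (φ.open_target.mem_nhds (by rw [hcu]; exact φ.map_source hφu))
    have h2 : ∀ᶠ q : N × M in 𝓝 (u, f u), q.2 ∈ ψ.source :=
      continuousAt_snd.eventually_mem (ψ.open_source.mem_nhds hψu)
    filter_upwards [h1, h2] with q hq1 hq2
    have hq : φ.symm (c q) ∈ φ.source := φ.map_target hq1
    refine ψ.injOn (h.source_subset_preimage_source hq) hq2 ?_
    rw [hloc _ hq, φ.right_inv hq1]
    simp [c]

theorem Manifold.IsSubmersionAt.mdifferentiableAt {f : N → M} {u : N}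
    (h : Manifold.IsSubmersionAt 𝓘(ℝ, EN) 𝓘(ℝ, EM) ∞ f u) :
    MDifferentiableAt 𝓘(ℝ, EN) 𝓘(ℝ, EM) f u :=
  h.contMDiffAt.mdifferentiableAt (by simp)

theorem Manifold.IsSubmersionAt.mfderiv_surjective {f : N → M} {u : N}
    (h : Manifold.IsSubmersionAt 𝓘(ℝ, EN) 𝓘(ℝ, EM) ∞ f u) :
    Function.Surjective (mfderiv 𝓘(ℝ, EN) 𝓘(ℝ, EM) f u) := by
  obtain ⟨r, hr, hr1, hr2⟩ := h.exists_lift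
  have hru : r (u, f u) = u := hr1.self_of_nhds
  have hrd := (hr.mdifferentiableAt (by simp)).hasMFDerivAt
  have hf : HasMFDerivAt 𝓘(ℝ, EN) 𝓘(ℝ, EM) f (r (u, f u)) (mfderiv 𝓘(ℝ, EN) 𝓘(ℝ, EM) f u) := by
    rw [hru]
    exact h.mdifferentiableAt.hasMFDerivAt
  have h1 := (HasMFDerivAt.comp (u, f u) hf hrd).congr_of_eventuallyEq
    (f₁ := Prod.snd) (hr2.mono fun q hq => hq.symm)
  have h2 := hasMFDerivAt_unique h1 (hasMFDerivAt_snd (u, f u))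
  intro w
  refine ⟨_, DFunLike.congr_fun h2 ((0, w) : EN × EM)⟩

end Submersion

/-! ### The differential of the multiplication -/

section Groupoid

variable
  {EG : Type*} [NormedAddCommGroup EG] [NormedSpace ℝ EG]
  {G : Type*} [TopologicalSpace G] [ChartedSpace EG G]
  {EM : Type*} [NormedAddCommGroup EM] [NormedSpace ℝ EM]
  {M : Type*} [TopologicalSpace M] [ChartedSpace EM M]

/-- In the model space, the identification of tangent spaces at equal points is the identity. -/
theorem tangentCast_apply {x y : M} (h : x = y) (v : TangentSpace 𝓘(ℝ, EM) x) :
    (tangentCast h v : EM) = (v : EM) := by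
  subst h
  rfl

/-- If `f ∘ m` agrees with `k` on composable pairs, then `df ∘ dm` agrees with `dk` on the vectors
tangent to the submanifold of composable pairs. Since derivatives within that subset are not
unique, `m` is first precomposed with a local retraction of `G × G` onto it. -/
theorem LieGroupoid.mfderiv_dmul (𝒢 : LieGroupoid EG G EM M) [IsManifold 𝓘(ℝ, EG) ∞ G]
    {f : G → M} {k : G × G → M}
    (hfk : ∀ p ∈ 𝒢.composable, f (𝒢.mul p.1 p.2) = k p) {u u' : G} (h : 𝒢.s u = 𝒢.t u')
    (hf : MDifferentiableAt 𝓘(ℝ, EG) 𝓘(ℝ, EM) f (𝒢.mul u u'))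
    {k' : EG × EG →L[ℝ] EM}
    (hk : HasMFDerivAt (𝓘(ℝ, EG).prod 𝓘(ℝ, EG)) 𝓘(ℝ, EM) k (u, u') k')
    {v v' : EG} (hv : (𝒢.ds u v : EM) = 𝒢.dt u' v') :
    (mfderiv 𝓘(ℝ, EG) 𝓘(ℝ, EM) f (𝒢.mul u u') (𝒢.dmul u u' v v') : EM) = k' (v, v') := by
  have hs := 𝒢.isSubmersion_s.isSubmersionAt u
  have ht := (𝒢.isSubmersion_t.isSubmersionAt u').mdifferentiableAt
  obtain ⟨r, hr, hr1, hr2⟩ := hs.exists_lift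
  have hru : r (u, 𝒢.s u) = u := hr1.self_of_nhds
  -- All differentials are named as maps between model spaces, so that base points that are equal
  -- only propositionally do not obstruct their composition.
  obtain ⟨r', hr'⟩ : ∃ r' : EG × EM →L[ℝ] EG,
      HasMFDerivAt (𝓘(ℝ, EG).prod 𝓘(ℝ, EM)) 𝓘(ℝ, EG) r (u, 𝒢.s u) r' :=
    ⟨_, (hr.mdifferentiableAt (by simp)).hasMFDerivAt⟩
  obtain ⟨s', hs'⟩ : ∃ s' : EG →L[ℝ] EM, s' = mfderiv 𝓘(ℝ, EG) 𝓘(ℝ, EM) 𝒢.s u := ⟨_, rfl⟩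
  obtain ⟨t', ht'⟩ : ∃ t' : EG →L[ℝ] EM, t' = mfderiv 𝓘(ℝ, EG) 𝓘(ℝ, EM) 𝒢.t u' := ⟨_, rfl⟩
  have hsd : HasMFDerivAt 𝓘(ℝ, EG) 𝓘(ℝ, EM) 𝒢.s u s' := hs' ▸ hs.mdifferentiableAt.hasMFDerivAt
  have htd : HasMFDerivAt 𝓘(ℝ, EG) 𝓘(ℝ, EM) 𝒢.t u' t' := ht' ▸ ht.hasMFDerivAt
  -- `r` fixes pairs of the form `(p, s p)`, hence `r'` fixes vectors of the form `(v, ds v)`.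
  have hr'v : r' (v, s' v) = v := by
    have h1 : HasMFDerivAt 𝓘(ℝ, EG) 𝓘(ℝ, EG) (fun p => r (p, 𝒢.s p)) u
        (r' ∘L ((ContinuousLinearMap.id ℝ EG).prod s')) :=
      HasMFDerivAt.comp u hr' ((hasMFDerivAt_id u).prodMk hsd)
    have h2 := hasMFDerivAt_unique ((hasMFDerivAt_id u).congr_of_eventuallyEq
      (f₁ := fun p => r (p, 𝒢.s p)) hr1) h1
    exact (DFunLike.congr_fun h2 v).symm
  have hvt : t' v' = s' v := by
    rw [hs', ht']
    exact hv.symm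
  let Ψ : G × G → G × G := fun q => (r (q.1, 𝒢.t q.2), q.2)
  have hΨu : Ψ (u, u') = (u, u') := by simp [Ψ, ← h, hru]
  obtain ⟨Ψ', hΨ, hΨv⟩ : ∃ Ψ' : EG × EG →L[ℝ] EG × EG,
      HasMFDerivAt (𝓘(ℝ, EG).prod 𝓘(ℝ, EG)) (𝓘(ℝ, EG).prod 𝓘(ℝ, EG)) Ψ (u, u') Ψ' ∧
      Ψ' (v, v') = (v, v') := by
    have h1 : HasMFDerivAt (𝓘(ℝ, EG).prod 𝓘(ℝ, EG)) 𝓘(ℝ, EM) (fun q : G × G => 𝒢.t q.2) (u, u')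
        (t' ∘L ContinuousLinearMap.snd ℝ EG EG) :=
      HasMFDerivAt.comp (u, u') (f := Prod.snd) (g := 𝒢.t) htd (hasMFDerivAt_snd (u, u'))
    have h2 : HasMFDerivAt (𝓘(ℝ, EG).prod 𝓘(ℝ, EG)) (𝓘(ℝ, EG).prod 𝓘(ℝ, EM))
        (fun q : G × G => (q.1, 𝒢.t q.2)) (u, u')
        ((ContinuousLinearMap.fst ℝ EG EG).prod (t' ∘L ContinuousLinearMap.snd ℝ EG EG)) :=
      (hasMFDerivAt_fst (u, u')).prodMk h1
    have h3 : HasMFDerivAt (𝓘(ℝ, EG).prod 𝓘(ℝ, EM)) 𝓘(ℝ, EG) r (u, 𝒢.t u') r' := h ▸ hr'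
    have h4 : HasMFDerivAt (𝓘(ℝ, EG).prod 𝓘(ℝ, EG)) 𝓘(ℝ, EG)
        (fun q : G × G => r (q.1, 𝒢.t q.2)) (u, u') (r' ∘L
          (ContinuousLinearMap.fst ℝ EG EG).prod (t' ∘L ContinuousLinearMap.snd ℝ EG EG)) :=
      HasMFDerivAt.comp (u, u') (g := r) h3 h2
    refine ⟨_, h4.prodMk (hasMFDerivAt_snd (u, u')), ?_⟩
    refine Prod.ext ?_ rfl
    change r' (v, t' v') = v
    rw [hvt, hr'v]
  have hmem : ∀ᶠ q in 𝓝 (u, u'), Ψ q ∈ 𝒢.composable := by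
    have hc : ContinuousAt (fun q : G × G => (q.1, 𝒢.t q.2)) (u, u') :=
      continuousAt_fst.prodMk (ContinuousAt.comp (f := Prod.snd) (g := 𝒢.t)
        (x := (u, u')) ht.continuousAt continuousAt_snd)
    have hc' := hc.tendsto
    simp only [← h] at hc'
    exact hc'.eventually hr2
  obtain ⟨m', hm'⟩ : ∃ m' : EG × EG →L[ℝ] EG, m' = mfderivWithin (𝓘(ℝ, EG).prod 𝓘(ℝ, EG)) 𝓘(ℝ, EG)
    (fun p : G × G => 𝒢.mul p.1 p.2) 𝒢.composable (u, u') := ⟨_, rfl⟩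
  have hm : HasMFDerivWithinAt (𝓘(ℝ, EG).prod 𝓘(ℝ, EG)) 𝓘(ℝ, EG)
      (fun p : G × G => 𝒢.mul p.1 p.2) 𝒢.composable (Ψ (u, u')) m' := by
    rw [hΨu, hm']
    exact ((𝒢.contMDiffOn_mul (u, u') h).mdifferentiableWithinAt (by simp)).hasMFDerivWithinAt
  have hmΨ : HasMFDerivAt (𝓘(ℝ, EG).prod 𝓘(ℝ, EG)) 𝓘(ℝ, EG)
      (fun q => 𝒢.mul (Ψ q).1 (Ψ q).2) (u, u') (m' ∘L Ψ') :=
    (HasMFDerivWithinAt.comp (u, u') (g := fun p : G × G => 𝒢.mul p.1 p.2) hm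
      (hΨ.hasMFDerivWithinAt (s := Ψ ⁻¹' 𝒢.composable)) subset_rfl).hasMFDerivAt hmem
  obtain ⟨f', hf'⟩ : ∃ f' : EG →L[ℝ] EM, f' = mfderiv 𝓘(ℝ, EG) 𝓘(ℝ, EM) f (𝒢.mul u u') := ⟨_, rfl⟩
  have hfd : HasMFDerivAt 𝓘(ℝ, EG) 𝓘(ℝ, EM) f (𝒢.mul (Ψ (u, u')).1 (Ψ (u, u')).2) f' := by
    rw [hΨu, hf']
    exact hf.hasMFDerivAt
  have hleft : HasMFDerivAt (𝓘(ℝ, EG).prod 𝓘(ℝ, EG)) 𝓘(ℝ, EM)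
      (fun q => f (𝒢.mul (Ψ q).1 (Ψ q).2)) (u, u') (f' ∘L (m' ∘L Ψ')) :=
    HasMFDerivAt.comp (u, u') hfd hmΨ
  have hkΨ : HasMFDerivAt (𝓘(ℝ, EG).prod 𝓘(ℝ, EG)) 𝓘(ℝ, EM) k (Ψ (u, u')) k' := hΨu.symm ▸ hk
  have hright : HasMFDerivAt (𝓘(ℝ, EG).prod 𝓘(ℝ, EG)) 𝓘(ℝ, EM)
      (fun q => f (𝒢.mul (Ψ q).1 (Ψ q).2)) (u, u') (k' ∘L Ψ') :=
    (HasMFDerivAt.comp (u, u') hkΨ hΨ).congr_of_eventuallyEq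
      (hmem.mono fun q hq => hfk _ hq)
  -- On a full neighbourhood of `(u, u')` derivatives are unique, and `Ψ'` fixes `(v, v')`.
  have key := DFunLike.congr_fun (hasMFDerivAt_unique hleft hright) ((v, v') : EG × EG)
  have key' : f' (m' (Ψ' (v, v'))) = k' (Ψ' (v, v')) := key
  rw [hΨv, hf', hm'] at key'
  exact key'

theorem LieGroupoid.ds_dmul (𝒢 : LieGroupoid EG G EM M) [IsManifold 𝓘(ℝ, EG) ∞ G] {u u' : G}
    (h : 𝒢.s u = 𝒢.t u') {v v' : EG} (hv : (𝒢.ds u v : EM) = 𝒢.dt u' v') :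
    (𝒢.ds (𝒢.mul u u') (𝒢.dmul u u' v v') : EM) = 𝒢.ds u' v' := by
  have hk : HasMFDerivAt (𝓘(ℝ, EG).prod 𝓘(ℝ, EG)) 𝓘(ℝ, EM) (fun q : G × G => 𝒢.s q.2) (u, u')
      ((𝒢.ds u' : EG →L[ℝ] EM) ∘L ContinuousLinearMap.snd ℝ EG EG) :=
    HasMFDerivAt.comp (u, u') (f := Prod.snd) (g := 𝒢.s)
      (𝒢.isSubmersion_s.isSubmersionAt u').mdifferentiableAt.hasMFDerivAt
      (hasMFDerivAt_snd (u, u'))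
  exact 𝒢.mfderiv_dmul (fun p hp => 𝒢.s_mul _ _ hp) h
    (𝒢.isSubmersion_s.isSubmersionAt _).mdifferentiableAt hk hv

theorem LieGroupoid.dt_dmul (𝒢 : LieGroupoid EG G EM M) [IsManifold 𝓘(ℝ, EG) ∞ G] {u u' : G}
    (h : 𝒢.s u = 𝒢.t u') {v v' : EG} (hv : (𝒢.ds u v : EM) = 𝒢.dt u' v') :
    (𝒢.dt (𝒢.mul u u') (𝒢.dmul u u' v v') : EM) = 𝒢.dt u v := by
  have hk : HasMFDerivAt (𝓘(ℝ, EG).prod 𝓘(ℝ, EG)) 𝓘(ℝ, EM) (fun q : G × G => 𝒢.t q.1) (u, u')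
      ((𝒢.dt u : EG →L[ℝ] EM) ∘L ContinuousLinearMap.fst ℝ EG EG) :=
    HasMFDerivAt.comp (u, u') (f := Prod.fst) (g := 𝒢.t)
      (𝒢.isSubmersion_t.isSubmersionAt u).mdifferentiableAt.hasMFDerivAt
      (hasMFDerivAt_fst (u, u'))
  exact 𝒢.mfderiv_dmul (fun p hp => 𝒢.t_mul _ _ hp) h
    (𝒢.isSubmersion_t.isSubmersionAt _).mdifferentiableAt hk hv

end Groupoid

/-! ### Riemannian submersions along sections -/

section SubmersionMetric

variable {EN : Type*} [NormedAddCommGroup EN] [NormedSpace ℝ EN]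
  {N : Type*} [TopologicalSpace N] [ChartedSpace EN N] [IsManifold 𝓘(ℝ, EN) ∞ N]
  {EM : Type*} [NormedAddCommGroup EM] [NormedSpace ℝ EM]
  {M : Type*} [TopologicalSpace M] [ChartedSpace EM M] [IsManifold 𝓘(ℝ, EM) ∞ M]

/-- The form that `η` induces at the point `u` on the tangent space of `M` at `f u`, through the
orthogonal complement of the fibre of `f`. It is a form on the model space, so that its values at
the points of a fibre can be compared. -/
noncomputable def pointQuotientForm (η : RiemMetric EN N) (f : N → M) (u : N) :
    EM →L[ℝ] EM →L[ℝ] ℝ :=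
  quotientForm (V := EN) (W := EM) (η.inner u) (mfderiv 𝓘(ℝ, EN) 𝓘(ℝ, EM) f u)

theorem IsRiemannianSubmersion.inner_eq [FiniteDimensional ℝ EN] [FiniteDimensional ℝ EM]
    {η : RiemMetric EN N} {g : RiemMetric EM M} {f : N → M} (h : IsRiemannianSubmersion η g f)
    (u : N) : g.inner (f u) = pointQuotientForm (EM := EM) η f u :=
  IsQuotientForm.eq_quotientForm (V := EN) (W := EM) (h.isometry u) (η.pos u)
    (h.isSubmersion.isSubmersionAt u).mfderiv_surjective

/-- A bilinear form on a tangent space, written in the trivialization at `x₀`. -/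
theorem inCoordinates_form_apply {x₀ x : M}
    (h : x ∈ (trivializationAt EM (TangentSpace 𝓘(ℝ, EM) : M → Type _) x₀).baseSet)
    (Q : TangentSpace 𝓘(ℝ, EM) x →L[ℝ] TangentSpace 𝓘(ℝ, EM) x →L[ℝ] ℝ) (v w : EM) :
    ContinuousLinearMap.inCoordinates EM (TangentSpace 𝓘(ℝ, EM)) (EM →L[ℝ] ℝ)
        (fun y : M => TangentSpace 𝓘(ℝ, EM) y →L[ℝ] ℝ) x₀ x x₀ x Q v w =
      Q (((trivializationAt EM (TangentSpace 𝓘(ℝ, EM) : M → Type _)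
          x₀).continuousLinearEquivAt ℝ x h).symm v)
        (((trivializationAt EM (TangentSpace 𝓘(ℝ, EM) : M → Type _)
          x₀).continuousLinearEquivAt ℝ x h).symm w) := by
  have key := inCoordinates_apply_eq₂ (𝕜 := ℝ) (F₁ := EM) (F₂ := EM) (F₃ := ℝ)
    (E₁ := fun y : M => TangentSpace 𝓘(ℝ, EM) y) (E₂ := fun y : M => TangentSpace 𝓘(ℝ, EM) y)
    (E₃ := Bundle.Trivial M ℝ) (ϕ := Q) (v := v) (w := w) h h (Set.mem_univ _)
  refine key.trans ?_
  simp

/-- The form induced at the points of a smooth section `σ` of a submersion depends smoothly on the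
base point. In trivializations of the tangent bundles it is again a quotient form, by naturality,
and quotient forms depend smoothly on the data. -/
theorem contMDiff_pointQuotientForm [FiniteDimensional ℝ EN] [FiniteDimensional ℝ EM]
    (η : RiemMetric EN N) {f : N → M} (hf : Manifold.IsSubmersion 𝓘(ℝ, EN) 𝓘(ℝ, EM) ∞ f)
    {σ : M → N} (hσ : ContMDiff 𝓘(ℝ, EM) 𝓘(ℝ, EN) ∞ σ) (hfσ : ∀ x, f (σ x) = x) :
    ContMDiff 𝓘(ℝ, EM) (𝓘(ℝ, EM).prod 𝓘(ℝ, EM →L[ℝ] EM →L[ℝ] ℝ)) ∞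
      (fun x : M => Bundle.TotalSpace.mk' (EM →L[ℝ] EM →L[ℝ] ℝ)
        (E := fun x : M => TangentSpace 𝓘(ℝ, EM) x →L[ℝ] TangentSpace 𝓘(ℝ, EM) x →L[ℝ] ℝ)
        x (pointQuotientForm (EM := EM) η f (σ x))) := by
  intro x₀
  rw [contMDiffAt_hom_bundle]
  refine ⟨contMDiffAt_id, ?_⟩
  have hA : ContMDiffAt 𝓘(ℝ, EM) 𝓘(ℝ, EN →L[ℝ] EM) ∞
      (inTangentCoordinates 𝓘(ℝ, EN) 𝓘(ℝ, EM) σ (fun x => f (σ x))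
        (fun x => mfderiv 𝓘(ℝ, EN) 𝓘(ℝ, EM) f (σ x)) x₀) x₀ :=
    ContMDiffAt.mfderiv (fun _ => f) σ
      (ContMDiffAt.comp (x₀, σ x₀) (g := f) (f := Prod.snd) hf.contMDiff.contMDiffAt
        contMDiffAt_snd) hσ.contMDiffAt (by simp)
  have hB := ((contMDiffAt_hom_bundle _).1 (η.contMDiff (σ x₀))).2.comp x₀ hσ.contMDiffAt
  let eM := trivializationAt EM (TangentSpace 𝓘(ℝ, EM) : M → Type _) x₀
  let eN := trivializationAt EN (TangentSpace 𝓘(ℝ, EN) : N → Type _) (σ x₀)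
  have hmemM : ∀ᶠ x in 𝓝 x₀, x ∈ eM.baseSet :=
    eM.open_baseSet.mem_nhds (FiberBundle.mem_baseSet_trivializationAt' x₀)
  have hmemN : ∀ᶠ x in 𝓝 x₀, σ x ∈ eN.baseSet :=
    hσ.continuous.continuousAt.eventually_mem
      (eN.open_baseSet.mem_nhds (FiberBundle.mem_baseSet_trivializationAt' (σ x₀)))
  -- The coordinate expression of the differential, with base points `f (σ x)` replaced by `x`.
  have hAeq : ∀ x (hM : x ∈ eM.baseSet) (hN : σ x ∈ eN.baseSet) (v : EN),
      inTangentCoordinates 𝓘(ℝ, EN) 𝓘(ℝ, EM) σ (fun x => f (σ x))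
        (fun x => mfderiv 𝓘(ℝ, EN) 𝓘(ℝ, EM) f (σ x)) x₀ x v =
      eM.continuousLinearEquivAt ℝ x hM ((mfderiv 𝓘(ℝ, EN) 𝓘(ℝ, EM) f (σ x) : EN →L[ℝ] EM)
        ((eN.continuousLinearEquivAt ℝ (σ x) hN).symm v)) := by
    intro x hM hN v
    have hcast : ∀ (y₀ y : M) (D : EN →L[ℝ] EM), y₀ = x₀ → y = x →
        ContinuousLinearMap.inCoordinates EN (TangentSpace 𝓘(ℝ, EN)) EM (TangentSpace 𝓘(ℝ, EM))
          (σ x₀) (σ x) y₀ y D =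
        ContinuousLinearMap.inCoordinates EN (TangentSpace 𝓘(ℝ, EN)) EM (TangentSpace 𝓘(ℝ, EM))
          (σ x₀) (σ x) x₀ x D := by
      rintro y₀ y D rfl rfl
      rfl
    refine (DFunLike.congr_fun (hcast _ _ _ (hfσ x₀) (hfσ x)) v).trans ?_
    exact DFunLike.congr_fun (ContinuousLinearMap.inCoordinates_eq (σ := RingHom.id ℝ) (F := EN)
      (x₀ := σ x₀) (x := σ x) (y₀ := x₀) (y := x)
      (E := fun y : N => TangentSpace 𝓘(ℝ, EN) y) (F' := EM)
      (E' := fun y : M => TangentSpace 𝓘(ℝ, EM) y)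
      (ϕ := (mfderiv 𝓘(ℝ, EN) 𝓘(ℝ, EM) f (σ x) : EN →L[ℝ] EM)) hN hM) v
  let Ac : M → EN →L[ℝ] EM := inTangentCoordinates 𝓘(ℝ, EN) 𝓘(ℝ, EM) σ (fun x => f (σ x))
    (fun x => mfderiv 𝓘(ℝ, EN) 𝓘(ℝ, EM) f (σ x)) x₀
  let Bc : M → EN →L[ℝ] EN →L[ℝ] ℝ := fun x =>
    ContinuousLinearMap.inCoordinates EN (TangentSpace 𝓘(ℝ, EN)) (EN →L[ℝ] ℝ)
      (fun y : N => TangentSpace 𝓘(ℝ, EN) y →L[ℝ] ℝ) (σ x₀) (σ x) (σ x₀) (σ x) (η.inner (σ x))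
  have hpos : ∀ v, v ≠ 0 → 0 < Bc x₀ v v := fun v hv => by
    change 0 < ContinuousLinearMap.inCoordinates EN (TangentSpace 𝓘(ℝ, EN)) (EN →L[ℝ] ℝ)
      (fun y : N => TangentSpace 𝓘(ℝ, EN) y →L[ℝ] ℝ) (σ x₀) (σ x₀) (σ x₀) (σ x₀)
      (η.inner (σ x₀)) v v
    rw [inCoordinates_form_apply hmemN.self_of_nhds]
    exact η.pos _ _ ((ContinuousLinearEquiv.map_eq_zero_iff _).not.2 hv)
  have hsurj : ∀ u, Function.Surjective (mfderiv 𝓘(ℝ, EN) 𝓘(ℝ, EM) f u) :=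
    fun u => (hf.isSubmersionAt u).mfderiv_surjective
  have hAc : Function.Surjective (Ac x₀) := fun w => by
    obtain ⟨v, hv⟩ := hsurj (σ x₀)
      ((eM.continuousLinearEquivAt ℝ x₀ hmemM.self_of_nhds).symm w : EM)
    refine ⟨eN.continuousLinearEquivAt ℝ (σ x₀) hmemN.self_of_nhds v, ?_⟩
    refine (hAeq x₀ hmemM.self_of_nhds hmemN.self_of_nhds _).trans ?_
    rw [ContinuousLinearEquiv.symm_apply_apply]
    exact (congrArg (eM.continuousLinearEquivAt ℝ x₀ hmemM.self_of_nhds) hv).trans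
      (ContinuousLinearEquiv.apply_symm_apply _ w)
  refine (ContMDiffAt.quotientForm (B := Bc) (A := Ac) hB hA hpos hAc).congr_of_eventuallyEq ?_
  filter_upwards [hmemM, hmemN] with x hM hN
  ext v w
  refine (inCoordinates_form_apply hM (pointQuotientForm (EM := EM) η f (σ x)) v w).trans ?_
  exact (quotientForm_congr (V := EN) (V' := EN) (W := EM) (W' := EM)
    (eN.continuousLinearEquivAt ℝ (σ x) hN).symm (eM.continuousLinearEquivAt ℝ x hM)
    (fun v w => inCoordinates_form_apply hN (η.inner (σ x)) v w) (hAeq x hM hN)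
    (η.pos (σ x)) (hsurj (σ x)) v w).symm

/-- If the forms induced at the points of each fibre of a submersion agree, then the submersion is
Riemannian for the common form, whose smoothness can be checked along a smooth section. -/
theorem exists_isRiemannianSubmersion [FiniteDimensional ℝ EN] [FiniteDimensional ℝ EM]
    (η : RiemMetric EN N) {f : N → M} (hf : Manifold.IsSubmersion 𝓘(ℝ, EN) 𝓘(ℝ, EM) ∞ f)
    {σ : M → N} (hσ : ContMDiff 𝓘(ℝ, EM) 𝓘(ℝ, EN) ∞ σ) (hfσ : ∀ x, f (σ x) = x)
    (hη : ∀ u, pointQuotientForm (EM := EM) η f u = pointQuotientForm (EM := EM) η f (σ (f u))) :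
    ∃ g : RiemMetric EM M, IsRiemannianSubmersion η g f := by
  have hsurj : ∀ u, Function.Surjective (mfderiv 𝓘(ℝ, EN) 𝓘(ℝ, EM) f u) :=
    fun u => (hf.isSubmersionAt u).mfderiv_surjective
  refine ⟨{ inner := fun x => pointQuotientForm (EM := EM) η f (σ x)
            symm := fun x => quotientForm_symm (V := EN) (W := EM) (η.symm _) (η.pos _) (hsurj _)
            pos := fun x => quotientForm_pos (V := EN) (W := EM) (η.pos _) (hsurj _)
            isVonNBounded := fun x => isVonNBounded_of_posDef (V := EM) _
              (quotientForm_pos (V := EN) (W := EM) (η.pos _) (hsurj _))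
            contMDiff := contMDiff_pointQuotientForm η hf hσ hfσ }, hf, fun x => ⟨σ x, hfσ x⟩, ?_⟩
  intro u v w hv hw
  change pointQuotientForm (EM := EM) η f (σ (f u)) _ _ = _
  rw [← hη u]
  exact isQuotientForm_quotientForm (V := EN) (W := EM) (η.pos u) (hsurj u) v w hv hw

end SubmersionMetric

/-! ### Translations and inversion -/

section Translations

variable
  {EG : Type*} [NormedAddCommGroup EG] [NormedSpace ℝ EG]
  {G : Type*} [TopologicalSpace G] [ChartedSpace EG G] [IsManifold 𝓘(ℝ, EG) ∞ G]
  {EM : Type*} [NormedAddCommGroup EM] [NormedSpace ℝ EM]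
  {M : Type*} [TopologicalSpace M] [ChartedSpace EM M]

theorem CartanLieGroupoid.ds_sLift (𝒢 : CartanLieGroupoid EG G EM M) (u : G)
    (w : TangentSpace 𝓘(ℝ, EM) (𝒢.s u)) : 𝒢.ds u (𝒢.sLift u w) = w :=
  (LinearEquiv.ofBijective _ (𝒢.s_projectible u)).apply_symm_apply w

theorem CartanLieGroupoid.dt_tLift (𝒢 : CartanLieGroupoid EG G EM M) (u : G)
    (w : TangentSpace 𝓘(ℝ, EM) (𝒢.t u)) : 𝒢.dt u (𝒢.tLift u w) = w :=
  (LinearEquiv.ofBijective _ (𝒢.t_projectible u)).apply_symm_apply w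

variable [FiniteDimensional ℝ EG] [FiniteDimensional ℝ EM]

/-- Left translations are isometries that intertwine `ds`, so they preserve the form induced
by `s`. -/
theorem CartanLieGroupoid.pointQuotientForm_s_mul (𝒢 : CartanLieGroupoid EG G EM M)
    {η : RiemMetric EG G} (hη : 𝒢.IsBiInvariant η) {u u' : G} (h : 𝒢.s u = 𝒢.t u') :
    pointQuotientForm (EM := EM) η 𝒢.s (𝒢.mul u u') = pointQuotientForm (EM := EM) η 𝒢.s u' := by
  let lift : EG →ₗ[ℝ] EG := (𝒢.H u).subtype ∘ₗ (𝒢.sLift u).toLinearMap ∘ₗ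
    (tangentCast h.symm).toLinearMap ∘ₗ (𝒢.dt u').toLinearMap
  let D : EG × EG →L[ℝ] EG := mfderivWithin (𝓘(ℝ, EG).prod 𝓘(ℝ, EG)) 𝓘(ℝ, EG)
    (fun p : G × G => 𝒢.mul p.1 p.2) 𝒢.composable (u, u')
  let L : EG →ₗ[ℝ] EG := D.toLinearMap ∘ₗ lift.prod LinearMap.id
  refine quotientForm_eq_of_isometry (V := EG) (V' := EG) (W := EM) rfl L
    (hη u u' h).1 (fun v => ?_) (η.pos _) (η.pos _)
    (𝒢.isSubmersion_s.isSubmersionAt _).mfderiv_surjective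
  refine 𝒢.ds_dmul h (v := lift v) (v' := v) ?_
  exact (𝒢.ds_sLift u _).trans (tangentCast_apply h.symm _)

/-- Right translations are isometries that intertwine `dt`, so they preserve the form induced
by `t`. -/
theorem CartanLieGroupoid.pointQuotientForm_t_mul (𝒢 : CartanLieGroupoid EG G EM M)
    {η : RiemMetric EG G} (hη : 𝒢.IsBiInvariant η) {u u' : G} (h : 𝒢.s u = 𝒢.t u') :
    pointQuotientForm (EM := EM) η 𝒢.t (𝒢.mul u u') = pointQuotientForm (EM := EM) η 𝒢.t u := by
  let lift : EG →ₗ[ℝ] EG := (𝒢.H u').subtype ∘ₗ (𝒢.tLift u').toLinearMap ∘ₗ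
    (tangentCast h).toLinearMap ∘ₗ (𝒢.ds u).toLinearMap
  let D : EG × EG →L[ℝ] EG := mfderivWithin (𝓘(ℝ, EG).prod 𝓘(ℝ, EG)) 𝓘(ℝ, EG)
    (fun p : G × G => 𝒢.mul p.1 p.2) 𝒢.composable (u, u')
  let L : EG →ₗ[ℝ] EG := D.toLinearMap ∘ₗ LinearMap.id.prod lift
  refine quotientForm_eq_of_isometry (V := EG) (V' := EG) (W := EM) rfl L
    (hη u u' h).2 (fun v => ?_) (η.pos _) (η.pos _)
    (𝒢.isSubmersion_t.isSubmersionAt _).mfderiv_surjective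
  refine 𝒢.dt_dmul h (v := v) (v' := lift v) ?_
  exact ((𝒢.dt_tLift u' _).trans (tangentCast_apply h _)).symm

/-- If inversion is an isometry, it exchanges the forms induced by `s` and `t`,
since `t ∘ ι = s`. -/
theorem CartanLieGroupoid.pointQuotientForm_t_inv (𝒢 : CartanLieGroupoid EG G EM M)
    {η : RiemMetric EG G} (hη : 𝒢.IsInversionInvariant η) (u : G) :
    pointQuotientForm (EM := EM) η 𝒢.t (𝒢.inv u) = pointQuotientForm (EM := EM) η 𝒢.s u := by
  refine quotientForm_eq_of_isometry (V := EG) (V' := EG) (W := EM) rfl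
    (𝒢.dinv u).toLinearMap (hη u) (fun v => ?_) (η.pos _) (η.pos _)
    (𝒢.isSubmersion_s.isSubmersionAt _).mfderiv_surjective
  have h1 := HasMFDerivAt.comp u
    (𝒢.isSubmersion_t.isSubmersionAt (𝒢.inv u)).mdifferentiableAt.hasMFDerivAt
    (𝒢.contMDiff_inv.contMDiffAt.mdifferentiableAt (by simp)).hasMFDerivAt
  have h2 : 𝒢.t ∘ 𝒢.inv = 𝒢.s := funext 𝒢.t_inv
  rw [h2] at h1
  exact DFunLike.congr_fun (hasMFDerivAt_unique h1
    (𝒢.isSubmersion_s.isSubmersionAt u).mdifferentiableAt.hasMFDerivAt) v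

end Translations

theorem mainTheorem3
    {EG : Type*} [NormedAddCommGroup EG] [NormedSpace ℝ EG] [FiniteDimensional ℝ EG]
    {G : Type*} [TopologicalSpace G] [ChartedSpace EG G] [IsManifold 𝓘(ℝ, EG) ∞ G]
    {EM : Type*} [NormedAddCommGroup EM] [NormedSpace ℝ EM] [FiniteDimensional ℝ EM]
    {M : Type*} [TopologicalSpace M] [ChartedSpace EM M] [IsManifold 𝓘(ℝ, EM) ∞ M]
    (𝒢 : CartanLieGroupoid EG G EM M) (η : RiemMetric EG G) (hη : 𝒢.IsBiInvariant η) :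
    (∃ g₁ g₂ : RiemMetric EM M,
      IsRiemannianSubmersion η g₁ 𝒢.s ∧ IsRiemannianSubmersion η g₂ 𝒢.t) ∧
    (𝒢.IsInversionInvariant η → ∀ g₁ g₂ : RiemMetric EM M,
      IsRiemannianSubmersion η g₁ 𝒢.s → IsRiemannianSubmersion η g₂ 𝒢.t → g₁ = g₂) := by
  refine ⟨?_, fun hinv g₁ g₂ h₁ h₂ => ?_⟩
  · -- Every `u` is the left translate by `u` of the unit at `s u`.
    obtain ⟨g₁, hg₁⟩ := exists_isRiemannianSubmersion η 𝒢.isSubmersion_s 𝒢.contMDiff_one 𝒢.s_one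
      fun u => by
        have := 𝒢.pointQuotientForm_s_mul hη (𝒢.t_one (𝒢.s u)).symm
        rwa [𝒢.mul_one] at this
    -- Every `u` is the right translate by `u` of the unit at `t u`.
    obtain ⟨g₂, hg₂⟩ := exists_isRiemannianSubmersion η 𝒢.isSubmersion_t 𝒢.contMDiff_one 𝒢.t_one
      fun u => by
        have := 𝒢.pointQuotientForm_t_mul hη (𝒢.s_one (𝒢.t u))
        rwa [𝒢.one_mul] at this
    exact ⟨g₁, g₂, hg₁, hg₂⟩
  · have hinner : g₁.inner = g₂.inner := by
      funext x
      obtain ⟨u, rfl⟩ := h₁.surjective x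
      have h := (h₁.inner_eq u).trans
        ((𝒢.pointQuotientForm_t_inv hinv u).symm.trans (h₂.inner_eq (𝒢.inv u)).symm)
      rw [𝒢.t_inv] at h
      exact h
    cases g₁
    cases g₂
    congr
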